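/- Consider the East process on $\Omega=\{0,1\}^{\mathbb Z}$ with parameter $q\in(0,1)$: let $\pi=\prod_{x\in\mathbb Z}\pi_x$, where each $\pi_x$ is the Bernoulli$(1-q)$ measure on $\{0,1\}$, let $c_x(\sigma)=1-\sigma(x+1)$, and let $\mathcal L$ be the generator acting on local functions $f:\Omega\to\mathbb R$ (functions depending on finitely many variables) by $$\mathcal L f(\sigma)=\sum_{x\in\mathbb Z}c_x(\sigma)\,[\pi_x(f)(\sigma)-f(\sigma)],$$ where $\pi_x(f)$ and $\operatorname{Var}_x(f)$ denote the mean and the variance of $f$ under $\pi_x$ in the variable $\sigma(x)$, all other variables being kept fixed. Its Dirichlet form is $\mathcal D(f)=-\pi(f\mathcal L f)=\sum_{x\in\mathbb Z}\pi\bigl(c_x\operatorname{Var}_x(f)\bigr)$, and its spectral gap is $$\operatorname{gap}(\mathcal L)=\inf\Bigl\{\frac{\mathcal D(f)}{\operatorname{Var}_\pi(f)}\;:\;f\text{ local and non-constant}\Bigr\}.$$ Then for every $\delta\in(0,1)$ there is a constant $C_\delta>0$, depending only on $\delta$, such that for all $q\in(0,1)$ $$\operatorname{gap}(\mathcal L)\le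 C_\delta\,q^{\log_2(1/q)\,(1-\delta)/2}.$$ In particular, $$\liminf_{q\downarrow0}\frac{\log\bigl(1/\operatorname{gap}(\mathcal L)\bigr)}{(\log(1/q))^2}\ge\frac1{2\log2},$$ where $\log(1/0)$ is read as $+\infty$. -/

import Mathlib

open MeasureTheory ProbabilityTheory Filter Topology

namespace EastModel

/-- Configurations of the East model on `ℤ`: `true` is an occupied site (occupancy variable `1`),
`false` is an empty site (occupancy variable `0`). -/
abbrev Config : Type := ℤ → Bool

/-- The single-site measure: occupied with probability `1 - q`, empty with probability `q`. -/
noncomputable def siteMeasure (q : unitInterval) : Measure Bool :=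
  bernoulliMeasure true false (unitInterval.symm q)

instance (q : unitInterval) : IsProbabilityMeasure (siteMeasure q) := by
  unfold siteMeasure; infer_instance

/-- The reversible measure: the product over `ℤ` of the Bernoulli(`1 - q`) measures. -/
noncomputable def stationaryMeasure (q : unitInterval) : Measure Config :=
  Measure.infinitePi fun _ : ℤ => siteMeasure q

instance (q : unitInterval) : IsProbabilityMeasure (stationaryMeasure q) := by
  unfold stationaryMeasure; infer_instance

/-- A function is local if it depends on finitely many occupancy variables. -/
def IsLocal (f : Config → ℝ) : Prop :=
  ∃ s : Finset ℤ, DependsOn f (s : Set ℤ)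

/-- The constraint at `x`: it equals `1` if the site `x + 1` is empty, and `0` otherwise. -/
def constraint (x : ℤ) (σ : Config) : ℝ :=
  if σ (x + 1) then 0 else 1

/-- The mean of `f` over the occupancy variable at `x`, all the others being kept fixed. -/
noncomputable def siteMean (q : unitInterval) (x : ℤ) (f : Config → ℝ) (σ : Config) : ℝ :=
  ∫ s, f (Function.update σ x s) ∂(siteMeasure q)

/-- The variance of `f` in the occupancy variable at `x`, all the others being kept fixed. -/
noncomputable def siteVariance (q : unitInterval) (x : ℤ) (f : Config → ℝ) (σ : Config) : ℝ :=
  variance (fun s => f (Function.update σ x s)) (siteMeasure q)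

/-- The generator of the East process, on local functions (the sum then has finitely many nonzero
terms). -/
noncomputable def generator (q : unitInterval) (f : Config → ℝ) (σ : Config) : ℝ :=
  ∑' x : ℤ, constraint x σ * (siteMean q x f σ - f σ)

/-- The Dirichlet form of the generator, on local functions; see
`dirichletForm_eq_neg_integral_mul_generator`. -/
noncomputable def dirichletForm (q : unitInterval) (f : Config → ℝ) : ℝ :=
  ∑' x : ℤ, ∫ σ, constraint x σ * siteVariance q x f σ ∂(stationaryMeasure q)

/-- The spectral gap of the generator: the infimum of `dirichletForm q f / Var f` over the local
functions `f` that are not almost surely constant. -/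
noncomputable def spectralGap (q : unitInterval) : ℝ :=
  sInf {r : ℝ | ∃ f : Config → ℝ, IsLocal f ∧ variance f (stationaryMeasure q) ≠ 0 ∧
    r = dirichletForm q f / variance f (stationaryMeasure q)}

theorem IsLocal.measurable {f : Config → ℝ} (hf : IsLocal f) : Measurable f := by
  obtain ⟨s, hs⟩ := hf
  obtain ⟨g, rfl⟩ := dependsOn_iff_exists_comp.1 hs
  have hg : Measurable g := measurable_of_countable g
  exact hg.comp (by fun_prop)

theorem IsLocal.bounded {f : Config → ℝ} (hf : IsLocal f) : ∃ C : ℝ, ∀ σ, ‖f σ‖ ≤ C := by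
  obtain ⟨s, hs⟩ := hf
  obtain ⟨g, rfl⟩ := dependsOn_iff_exists_comp.1 hs
  obtain ⟨C, hC⟩ := (Set.finite_range fun y => ‖g y‖).bddAbove
  exact ⟨C, fun σ => hC ⟨_, rfl⟩⟩

theorem IsLocal.integrable {f : Config → ℝ} (hf : IsLocal f) (q : unitInterval) :
    Integrable f (stationaryMeasure q) := by
  obtain ⟨C, hC⟩ := hf.bounded
  exact Integrable.of_bound hf.measurable.aestronglyMeasurable C (Eventually.of_forall hC)

theorem IsLocal.op₂ {f g : Config → ℝ} (hf : IsLocal f) (hg : IsLocal g) (F : ℝ → ℝ → ℝ) :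
    IsLocal fun σ => F (f σ) (g σ) := by
  obtain ⟨s, hs⟩ := hf
  obtain ⟨t, ht⟩ := hg
  classical
  refine ⟨s ∪ t, fun σ τ h => ?_⟩
  simp only
  rw [hs fun i hi => h i (by simp_all), ht fun i hi => h i (by simp_all)]

theorem isLocal_constraint (x : ℤ) : IsLocal (constraint x) :=
  ⟨{x + 1}, fun σ τ h => by simp [constraint, h (x + 1) (by simp)]⟩

theorem siteMean_eq (q : unitInterval) (x : ℤ) (f : Config → ℝ) (σ : Config) :
    siteMean q x f σ = (1 - (q : ℝ)) * f (Function.update σ x true)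
      + (q : ℝ) * f (Function.update σ x false) := by
  simp [siteMean, siteMeasure, integral_bernoulliMeasure]

theorem IsLocal.siteMean {f : Config → ℝ} (hf : IsLocal f) (q : unitInterval) (x : ℤ) :
    IsLocal (siteMean q x f) := by
  obtain ⟨s, hs⟩ := hf
  refine ⟨s, fun σ τ h => ?_⟩
  have : ∀ b, f (Function.update σ x b) = f (Function.update τ x b) := fun b => hs fun i hi => by
    by_cases hx : i = x
    · subst hx; simp
    · simp [hx, h i hi]
  simp [siteMean_eq, this]

theorem siteVariance_eq (q : unitInterval) (x : ℤ) (f : Config → ℝ) (σ : Config) :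
    siteVariance q x f σ = siteMean q x (fun τ => f τ ^ 2) σ - siteMean q x f σ ^ 2 := by
  unfold siteVariance
  rw [variance_eq_sub]
  · rfl
  · exact MemLp.of_discrete

/-- Averaging over the occupancy variable at one site does not change the mean. -/
theorem integral_siteMean {f : Config → ℝ} (hf : IsLocal f) (q : unitInterval) (x : ℤ) :
    ∫ σ, siteMean q x f σ ∂(stationaryMeasure q) = ∫ σ, f σ ∂(stationaryMeasure q) := by
  have hu : Measurable fun z : Config × Bool => Function.update z.1 x z.2 := by
    refine measurable_pi_lambda _ fun i => ?_
    by_cases hi : i = x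
    · subst hi; simpa using measurable_snd
    · simp only [Function.update_of_ne hi]
      exact (measurable_pi_apply i).comp measurable_fst
  have hmap : ((stationaryMeasure q).prod (siteMeasure q)).map
      (fun z : Config × Bool => Function.update z.1 x z.2) = stationaryMeasure q := by
    refine Measure.eq_infinitePi _ fun s t ht => ?_
    classical
    rw [Measure.map_apply hu (MeasurableSet.pi s.countable_toSet fun i _ => ht i)]
    by_cases hx : x ∈ s
    · have : (fun z : Config × Bool => Function.update z.1 x z.2) ⁻¹' Set.pi s t
          = (Set.pi (s.erase x : Finset ℤ) t) ×ˢ t x := by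
        ext ⟨σ, b⟩
        simp only [Set.mem_preimage, Set.mem_pi, Set.mem_prod, Finset.mem_coe, Finset.mem_erase]
        constructor
        · intro h
          exact ⟨fun i hi => by simpa [hi.1] using h i hi.2, by simpa using h x hx⟩
        · rintro ⟨h1, h2⟩ i hi
          by_cases hix : i = x
          · subst hix; simpa using h2
          · simpa [hix] using h1 i ⟨hix, hi⟩
      rw [this, Measure.prod_prod, stationaryMeasure, Measure.infinitePi_pi _ fun i _ => ht i,
        Finset.prod_erase_mul _ _ hx]
    · have : (fun z : Config × Bool => Function.update z.1 x z.2) ⁻¹' Set.pi s t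
          = (Set.pi s t) ×ˢ Set.univ := by
        ext ⟨σ, b⟩
        simp only [Set.mem_preimage, Set.mem_pi, Set.mem_prod, Finset.mem_coe, Set.mem_univ,
          and_true]
        refine forall₂_congr fun i hi => ?_
        rw [Function.update_of_ne]
        rintro rfl
        exact hx hi
      rw [this, Measure.prod_prod, stationaryMeasure, Measure.infinitePi_pi _ fun i _ => ht i,
        measure_univ, mul_one]
  have hi := hf.integrable q
  rw [← hmap] at hi
  conv_rhs => rw [← hmap]
  rw [integral_map hu.aemeasurable hi.aestronglyMeasurable, integral_prod]
  · rfl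
  · exact (integrable_map_measure hi.aestronglyMeasurable hu.aemeasurable).1 hi

/-- On local functions the Dirichlet form is the quadratic form of minus the generator. -/
theorem dirichletForm_eq_neg_integral_mul_generator {f : Config → ℝ} (hf : IsLocal f)
    (q : unitInterval) :
    dirichletForm q f = -∫ σ, f σ * generator q f σ ∂(stationaryMeasure q) := by
  obtain ⟨s, hs⟩ := id hf
  have hm : ∀ x ∉ s, ∀ b σ, f (Function.update σ x b) = f σ := fun x hx b σ => hs fun i hi => by
    rw [Function.update_of_ne]
    rintro rfl
    exact hx hi
  have hgen : ∀ σ, generator q f σ = ∑ x ∈ s, constraint x σ * (siteMean q x f σ - f σ) := by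
    intro σ
    refine tsum_eq_sum fun x hx => ?_
    simp only [siteMean_eq, hm x hx]
    ring
  have hdir : dirichletForm q f
      = ∑ x ∈ s, ∫ σ, constraint x σ * siteVariance q x f σ ∂(stationaryMeasure q) := by
    refine tsum_eq_sum fun x hx => ?_
    refine integral_eq_zero_of_ae (Eventually.of_forall fun σ => ?_)
    simp only [siteVariance_eq, siteMean_eq, hm x hx, Pi.zero_apply]
    ring
  have hloc : ∀ x, IsLocal fun σ => f σ * (constraint x σ * (siteMean q x f σ - f σ)) := fun x =>
    hf.op₂ ((isLocal_constraint x).op₂ ((hf.siteMean q x).op₂ hf (· - ·)) (· * ·)) (· * ·)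
  simp only [hgen, Finset.mul_sum]
  rw [integral_finsetSum _ fun x _ => (hloc x).integrable q, hdir, ← Finset.sum_neg_distrib]
  refine Finset.sum_congr rfl fun x _ => ?_
  rw [← integral_siteMean (hloc x) q x, ← integral_neg]
  refine integral_congr_ae (Eventually.of_forall fun σ => ?_)
  have hc : ∀ b, constraint x (Function.update σ x b) = constraint x σ := fun b => by
    simp [constraint]
  simp only [siteVariance_eq, siteMean_eq, hc, Function.update_idem]
  ring

end EastModel

/-! The gap is bounded by a bottleneck. Freeze an empty site at the origin, look at the window of
the `2 ^ k` sites to its left, and test with the indicator that all its empty sites can be removed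
by legal flips with at most `k` of them present at any time.

The test function changes under a legal flip only when exactly `k` empty sites are present and they
can still be removed within this budget. `IsErasing.mem_hierarchical` shows that such sets are
hierarchical: they are built point by point, each new point within `2 ^ (k - 1)`, ..., `2`, `1` of
an earlier one or of the origin. There are at most `k! * 2 ^ (k choose 2)` of them, each empty with
probability `q ^ k`, which controls the Dirichlet form. The spread of hierarchical sets is less than
`2 ^ k`, so an empty site at distance `2 ^ k` is never removable, while a fully occupied window
always is; this bounds the variance from below (`spectralGap_mul_le`).

Taking `k` to be the integer part of `n = logb 2 (1 / q)`, the main factor `2 ^ (k choose 2) * q ^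
k` is about `2 ^ (-n ^ 2 / 2)`, and `k! * 2 ^ k` is absorbed by `δ`. -/

namespace EastModel

/-! ### Legal steps and erasing sequences -/

/-- Finite sets of empty sites, given by their distances to a site that is always empty, which
agree except possibly at one site whose neighbour towards the origin is empty. -/
def LegalStep (S S' : Finset ℕ) : Prop :=
  ∃ x, (x = 0 ∨ (x ∈ S ∧ x ∈ S')) ∧ ∀ y, y ≠ x + 1 → (y ∈ S ↔ y ∈ S')

theorem LegalStep.symm {S S' : Finset ℕ} (h : LegalStep S S') : LegalStep S' S := by
  obtain ⟨x, hx, hS⟩ := h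
  exact ⟨x, hx.imp_right And.symm, fun y hy => (hS y hy).symm⟩

/-- A sequence of legal steps with at most `k` empty sites at all times, along which every
initially empty site gets occupied. -/
structure IsErasing (k τ : ℕ) (ω : ℕ → Finset ℕ) : Prop where
  step : ∀ s < τ, LegalStep (ω s) (ω (s + 1))
  card_le : ∀ s ≤ τ, (ω s).card ≤ k
  erased : ∀ y ∈ ω 0, ∃ s ≤ τ, y ∉ ω s

/-- Going back to the beginning and then forward again erases any intermediate configuration. -/
theorem IsErasing.rewind {k τ : ℕ} {ω : ℕ → Finset ℕ} (h : IsErasing k τ ω) :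
    IsErasing k (2 * τ) fun s => ω ((τ - s) + (s - τ)) where
  -- With truncated subtraction, the time index is `|τ - s|`.
  step s hs := by
    rcases lt_or_ge s τ with hsτ | hsτ
    · have h1 : τ - s + (s - τ) = τ - (s + 1) + (s + 1 - τ) + 1 := by omega
      rw [h1]
      exact (h.step _ (by omega)).symm
    · have h1 : τ - (s + 1) + (s + 1 - τ) = τ - s + (s - τ) + 1 := by omega
      rw [h1]
      exact h.step _ (by omega)
  card_le s hs := h.card_le _ (by omega)
  erased y _ := by
    by_cases hy : y ∈ ω 0
    · obtain ⟨s, hs, hys⟩ := h.erased y hy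
      refine ⟨τ + s, by omega, ?_⟩
      rwa [show τ - (τ + s) + (τ + s - τ) = s by omega]
    · refine ⟨τ, by omega, ?_⟩
      rwa [show τ - τ + (τ - τ) = 0 by omega]

/-! ### Hierarchical sets: spread and number -/

/-- The sets with `m` elements built by successively adding points, the last one at distance at
most `2 ^ a` above an earlier one or above `0`, the one before at distance at most `2 ^ (a + 1)`,
and so on. -/
def hierarchical : ℕ → ℕ → Finset (Finset ℕ)
  | _, 0 => {∅}
  | a, m + 1 => (hierarchical (a + 1) m).biUnion fun S => (insert 0 S).biUnion fun z =>
      (Finset.Icc 1 (2 ^ a)).image fun d => insert (z + d) S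

theorem mem_hierarchical_succ {a m : ℕ} {T : Finset ℕ} :
    T ∈ hierarchical a (m + 1) ↔ ∃ S ∈ hierarchical (a + 1) m, ∃ z, (z = 0 ∨ z ∈ S) ∧
      ∃ d, (1 ≤ d ∧ d ≤ 2 ^ a) ∧ insert (z + d) S = T := by
  simp only [hierarchical, Finset.mem_biUnion, Finset.mem_image, Finset.mem_insert,
    Finset.mem_Icc]

theorem card_le_of_mem_hierarchical {a m : ℕ} {S : Finset ℕ} (h : S ∈ hierarchical a m) :
    S.card ≤ m := by
  induction m generalizing a S with
  | zero => simp_all [hierarchical]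
  | succ m ih =>
    obtain ⟨S', hS', z, -, d, -, rfl⟩ := mem_hierarchical_succ.1 h
    exact (Finset.card_insert_le _ _).trans (Nat.succ_le_succ (ih hS'))

/-- The extreme point uses every maximal distance: `2 ^ a + ... + 2 ^ (a + m - 1) = 2 ^ (a + m) - 2
^ a`. -/
theorem add_two_pow_le_of_mem_hierarchical {a m : ℕ} {S : Finset ℕ} (h : S ∈ hierarchical a m)
    {x : ℕ} (hx : x ∈ S) : x + 2 ^ a ≤ 2 ^ (a + m) := by
  induction m generalizing a S x with
  | zero => simp_all [hierarchical]
  | succ m ih =>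
    obtain ⟨S', hS', z, hz, d, hd, rfl⟩ := mem_hierarchical_succ.1 h
    have h2 : 2 ^ (a + 1) = 2 ^ a + 2 ^ a := by ring
    have key : ∀ w, w = 0 ∨ w ∈ S' → w + 2 ^ (a + 1) ≤ 2 ^ (a + (m + 1)) := by
      rintro w (rfl | hw)
      · rw [zero_add]
        exact Nat.pow_le_pow_right (by norm_num) (by omega)
      · rw [show a + (m + 1) = a + 1 + m by ring]
        exact ih hS' hw
    rcases Finset.mem_insert.1 hx with rfl | hx
    · have := key z hz
      omega
    · have := key x (Or.inr hx)
      omega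

/-- The last point has at most `m` possible bases (earlier points and `0`) and `2 ^ a` distances;
the scales multiply to the power of two and the bases to the factorial. -/
theorem card_hierarchical_le (a m : ℕ) :
    (hierarchical a m).card ≤ m.factorial * 2 ^ (a * m + m.choose 2) := by
  induction m generalizing a with
  | zero => simp [hierarchical]
  | succ m ih =>
    have h1 : (hierarchical a (m + 1)).card ≤ (hierarchical (a + 1) m).card * ((m + 1) * 2 ^ a) := by
      refine Finset.card_biUnion_le_card_mul _ _ _ fun S hS => ?_
      calc _ ≤ (insert 0 S).card * 2 ^ a := Finset.card_biUnion_le_card_mul _ _ _ fun z _ =>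
            Finset.card_image_le.trans (by simp)
        _ ≤ _ := Nat.mul_le_mul_right _ ((Finset.card_insert_le _ _).trans
            (Nat.succ_le_succ (card_le_of_mem_hierarchical hS)))
    refine h1.trans ((Nat.mul_le_mul_right _ (ih (a + 1))).trans (le_of_eq ?_))
    rw [Nat.choose_succ_succ' m 1, Nat.choose_one_right, Nat.factorial_succ]
    ring

/-! ### Localisation to an interval, and the main combinatorial induction -/

/-- The trace of a set in an open interval, seen from its left end. -/
def traceBetween (z y : ℕ) (S : Finset ℕ) : Finset ℕ :=
  (Finset.Ico 1 (y - z)).filter fun x => z + x ∈ S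

theorem mem_traceBetween {z y x : ℕ} {S : Finset ℕ} :
    x ∈ traceBetween z y S ↔ (1 ≤ x ∧ x < y - z) ∧ z + x ∈ S := by
  simp [traceBetween]

/-- In the trace `z` becomes the site that is always empty, so a flip next to `z` stays legal. Flips
outside the open interval leave the trace unchanged. -/
theorem LegalStep.traceBetween {S S' : Finset ℕ} (h : LegalStep S S') (z y : ℕ) :
    LegalStep (traceBetween z y S) (traceBetween z y S') := by
  obtain ⟨x, hx, hS⟩ := h
  by_cases hxz : z ≤ x ∧ x + 1 < y
  · refine ⟨x - z, ?_, fun w hw => ?_⟩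
    · rcases hx with rfl | hx
      · left; omega
      · by_cases h0 : x - z = 0
        · exact Or.inl h0
        · right
          simp only [mem_traceBetween, show z + (x - z) = x by omega]
          exact ⟨⟨by omega, hx.1⟩, ⟨by omega, hx.2⟩⟩
    · simp only [mem_traceBetween, hS (z + w) (by omega)]
  · refine ⟨0, Or.inl rfl, fun w hw => ?_⟩
    simp only [mem_traceBetween]
    refine and_congr_right fun hw' => hS _ (by omega)

/-- The points of `T` are empty but lie outside the open interval, so they use up `T.card` of the
budget. -/
theorem card_traceBetween_le {z y k : ℕ} {S T : Finset ℕ} (hT : T ⊆ S) (hS : S.card ≤ k)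
    (hzy : ∀ x ∈ T, x ≤ z ∨ y ≤ x) : (traceBetween z y S).card ≤ k - T.card := by
  have : (traceBetween z y S).card ≤ (S \ T).card := by
    refine Finset.card_le_card_of_injOn (z + ·) (fun x hx => ?_) (add_right_injective z).injOn
    have hx := mem_traceBetween.1 hx
    refine Finset.mem_coe.2 (Finset.mem_sdiff.2 ⟨hx.2, fun h => ?_⟩)
    have : z + x ≤ z ∨ y ≤ z + x := hzy _ h
    omega
  rw [Finset.card_sdiff_of_subset hT] at this
  omega

/-- The initial configuration of an erasing sequence is hierarchical. -/
theorem IsErasing.mem_hierarchical {k τ : ℕ} {ω : ℕ → Finset ℕ} (h : IsErasing k τ ω) :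
    ω 0 ∈ hierarchical (k - (ω 0).card) (ω 0).card := by
  induction k using Nat.strong_induction_on generalizing τ ω with
  | _ k ih =>
  -- A smaller budget confines the final configuration too: rewound, the sequence starts from it, so
  -- by induction it is hierarchical.
  have bound : ∀ a < k, ∀ t ω', IsErasing a t ω' → ∀ x ∈ ω' t, x + 1 ≤ 2 ^ a := by
    intro a ha t ω' h' x hx
    have hm := ih a ha h'.rewind
    have hc := h'.card_le t le_rfl
    simp only [Nat.sub_zero, Nat.zero_sub, add_zero] at hm
    have h1 := add_two_pow_le_of_mem_hierarchical hm hx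
    rw [Nat.sub_add_cancel hc] at h1
    have := Nat.one_le_two_pow (n := a - (ω' t).card)
    omega
  -- `S t` collects the sites that stay empty throughout `[0, t]`. It decreases from `ω 0` to `∅`
  -- and loses at most one point per step; running time backwards rebuilds `ω 0` point by point.
  let S : ℕ → Finset ℕ := fun t => (ω 0).filter fun y => ∀ s ≤ t, y ∈ ω s
  have hS : ∀ t y, y ∈ S t ↔ ∀ s ≤ t, y ∈ ω s := fun t y => by
    simp only [S, Finset.mem_filter, and_iff_right_iff_imp]
    exact fun hy => hy 0 (Nat.zero_le _)
  have hS0 : S 0 = ω 0 := by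
    ext y
    simp [hS]
  suffices H : ∀ t ≤ τ, S t ∈ hierarchical (k - (S t).card) (S t).card by
    simpa only [hS0] using H 0 (Nat.zero_le _)
  intro t ht
  induction ht using Nat.decreasingInduction with
  | self =>
    have : S τ = ∅ := by
      refine Finset.eq_empty_of_forall_notMem fun y hy => ?_
      rw [hS] at hy
      obtain ⟨s, hs, hys⟩ := h.erased y (hy 0 (Nat.zero_le _))
      exact hys (hy s hs)
    simp [this, hierarchical]
  | of_succ t ht iht =>
    have hsub : S (t + 1) ⊆ S t := fun y hy => by
      rw [hS] at hy ⊢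
      exact fun s hs => hy s (by omega)
    by_cases heq : S t ⊆ S (t + 1)
    · rwa [heq.antisymm hsub]
    obtain ⟨y, hy, hy'⟩ := Finset.not_subset.1 heq
    obtain ⟨x, hx, hstep⟩ := h.step t ht
    have huniq : ∀ w ∈ S t, w ∉ S (t + 1) → w = x + 1 := fun w hw hw' => by
      by_contra hne
      refine hw' ((hS _ _).2 fun s hs => ?_)
      rcases Nat.le_succ_iff.1 hs with hs | rfl
      · exact (hS _ _).1 hw s hs
      · exact (hstep w hne).1 ((hS _ _).1 hw t le_rfl)
    have hyx : y = x + 1 := huniq y hy hy'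
    have hins : S t = insert y (S (t + 1)) := by
      ext w
      rw [Finset.mem_insert]
      refine ⟨fun hw => ?_, ?_⟩
      · by_cases hw' : w ∈ S (t + 1)
        · exact Or.inr hw'
        · exact Or.inl ((huniq w hw hw').trans hyx.symm)
      · rintro (rfl | hw)
        · exact hy
        · exact hsub hw
    have hcard : (S t).card = (S (t + 1)).card + 1 := by
      rw [hins, Finset.card_insert_of_notMem hy']
    have hck : ∀ s ≤ t, S t ⊆ ω s := fun s hs w hw => (hS _ _).1 hw s hs
    have hk : (S t).card ≤ k := (Finset.card_le_card (hck t le_rfl)).trans (h.card_le t ht.le)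
    -- The lost point `y` is attached to `z`, the nearest surviving point below it, or `0`.
    obtain ⟨z, ⟨hz, hzy⟩, hzmax⟩ : ∃ z, ((z = 0 ∨ z ∈ S (t + 1)) ∧ z < y) ∧
        ∀ w ∈ S (t + 1), w < y → w ≤ z := by
      have hne : ((insert 0 (S (t + 1))).filter (· < y)).Nonempty := ⟨0, by simp [hyx]⟩
      refine ⟨Finset.max' _ hne, ?_, fun w hw hwy => Finset.le_max' _ w
        (Finset.mem_filter.2 ⟨Finset.mem_insert_of_mem hw, hwy⟩)⟩
      have := Finset.max'_mem _ hne
      simpa only [Finset.mem_filter, Finset.mem_insert] using this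
    have hout : ∀ w ∈ S t, w ≤ z ∨ y ≤ w := fun w hw => by
      by_contra! hcon
      rw [hins, Finset.mem_insert] at hw
      rcases hw with rfl | hw
      · omega
      · have := hzmax w hw hcon.2
        omega
    -- Up to time `t` all of `S t` stays empty, so only `k - (S t).card` empty sites are left for
    -- the gap between `z` and `y`. Each site initially empty there is outside `S t`, hence occupied
    -- at some time.
    have herase : IsErasing (k - (S t).card) t fun s => traceBetween z y (ω s) :=
      { step := fun s hs => (h.step s (by omega)).traceBetween z y
        card_le := fun s hs => card_traceBetween_le (hck s hs) (h.card_le s (by omega)) hout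
        erased := fun w hw => by
          rw [mem_traceBetween] at hw
          have : z + w ∉ S t := fun hmem => by
            have := hout _ hmem
            omega
          rw [hS] at this
          push Not at this
          obtain ⟨s, hs, hws⟩ := this
          exact ⟨s, hs, fun hmem => hws (mem_traceBetween.1 hmem).2⟩ }
    -- When `y` flips, its neighbour `x` is empty: either `x = z`, or `x` lies in the trace and
    -- `bound` limits its distance to `z`.
    have hdist : y - z ≤ 2 ^ (k - (S t).card) := by
      by_cases hxz : x = z
      · have := Nat.one_le_two_pow (n := k - (S t).card)
        omega
      · have hx' : x - z ∈ traceBetween z y (ω t) := by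
          rw [mem_traceBetween, show z + (x - z) = x by omega]
          refine ⟨by omega, ?_⟩
          rcases hx with hx | hx
          · omega
          · exact hx.1
        have := bound _ (by omega) t _ herase _ hx'
        omega
    -- Having one point fewer raises the scale by one, matching the recursion of `hierarchical`.
    have e : k - (S (t + 1)).card = k - (S t).card + 1 := by omega
    rw [e] at iht
    rw [show hierarchical (k - (S t).card) (S t).card
      = hierarchical (k - (S t).card) ((S (t + 1)).card + 1) by rw [hcard], mem_hierarchical_succ]
    exact ⟨_, iht, z, hz, y - z, ⟨by omega, hdist⟩, by rw [Nat.add_sub_cancel' hzy.le, hins]⟩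

/-! ### Emptiable sets -/

/-- The set can be emptied by legal steps with at most `k` empty sites at all times. -/
def Emptiable (k : ℕ) (S : Finset ℕ) : Prop :=
  ∃ (τ : ℕ) (ω : ℕ → Finset ℕ), ω 0 = S ∧ ω τ = ∅ ∧
    (∀ s < τ, LegalStep (ω s) (ω (s + 1))) ∧ ∀ s ≤ τ, (ω s).card ≤ k

theorem emptiable_empty (k : ℕ) : Emptiable k ∅ :=
  ⟨0, fun _ => ∅, rfl, rfl, by simp, by simp⟩

theorem Emptiable.of_legalStep {k : ℕ} {S S' : Finset ℕ} (h : Emptiable k S)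
    (hstep : LegalStep S' S) (hS' : S'.card ≤ k) : Emptiable k S' := by
  obtain ⟨τ, ω, rfl, hτ, hs, hc⟩ := h
  refine ⟨τ + 1, fun s => Nat.casesOn s S' ω, rfl, hτ, fun s h => ?_, fun s h => ?_⟩
  · cases s with
    | zero => exact hstep
    | succ s => exact hs s (by omega)
  · cases s with
    | zero => exact hS'
    | succ s => exact hc s (by omega)

theorem Emptiable.card_le {k : ℕ} {S : Finset ℕ} (h : Emptiable k S) : S.card ≤ k := by
  obtain ⟨τ, ω, rfl, -, -, hc⟩ := h
  exact hc 0 (Nat.zero_le _)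

theorem Emptiable.mem_hierarchical {k : ℕ} {S : Finset ℕ} (h : Emptiable k S) :
    S ∈ hierarchical (k - S.card) S.card := by
  obtain ⟨τ, ω, rfl, hτ, hs, hc⟩ := h
  exact IsErasing.mem_hierarchical ⟨hs, hc, fun y _ => ⟨τ, le_rfl, by simp [hτ]⟩⟩

theorem Emptiable.lt_two_pow {k : ℕ} {S : Finset ℕ} (h : Emptiable k S) {x : ℕ} (hx : x ∈ S) :
    x < 2 ^ k := by
  have h1 := add_two_pow_le_of_mem_hierarchical h.mem_hierarchical hx
  rw [Nat.sub_add_cancel h.card_le] at h1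
  have := Nat.one_le_two_pow (n := k - S.card)
  omega

/-! ### The test function and its variance -/

section Measure

variable {q : unitInterval}

theorem siteVariance_eq_sq (q : unitInterval) (x : ℤ) (f : Config → ℝ) (σ : Config) :
    siteVariance q x f σ = (q : ℝ) * (1 - q) *
      (f (Function.update σ x true) - f (Function.update σ x false)) ^ 2 := by
  rw [siteVariance_eq, siteMean_eq, siteMean_eq]
  ring

theorem constraint_nonneg (x : ℤ) (σ : Config) : 0 ≤ constraint x σ := by
  unfold constraint
  split_ifs <;> norm_num

theorem dirichletForm_nonneg (q : unitInterval) (f : Config → ℝ) : 0 ≤ dirichletForm q f :=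
  tsum_nonneg fun x => integral_nonneg fun σ =>
    mul_nonneg (constraint_nonneg x σ) (variance_nonneg _ _)

/-- Every local function which is not almost surely constant bounds the spectral gap. -/
theorem spectralGap_le_div {f : Config → ℝ} (hf : IsLocal f)
    (hv : variance f (stationaryMeasure q) ≠ 0) :
    spectralGap q ≤ dirichletForm q f / variance f (stationaryMeasure q) := by
  refine csInf_le ⟨0, ?_⟩ ⟨f, hf, hv, rfl⟩
  rintro r ⟨g, -, -, rfl⟩
  exact div_nonneg (dirichletForm_nonneg q g) (variance_nonneg _ _)

/-- The event that all the sites of `s` have the same given state. -/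
def constantOn (s : Finset ℤ) (b : Bool) : Set Config :=
  Set.pi s fun _ => {b}

theorem mem_constantOn {s : Finset ℤ} {b : Bool} {σ : Config} :
    σ ∈ constantOn s b ↔ ∀ x ∈ s, σ x = b := by
  simp [constantOn, Set.mem_pi]

theorem measurableSet_constantOn (s : Finset ℤ) (b : Bool) : MeasurableSet (constantOn s b) :=
  MeasurableSet.pi s.countable_toSet fun _ _ => measurableSet_singleton b

theorem measureReal_constantOn (q : unitInterval) (s : Finset ℤ) (b : Bool) :
    (stationaryMeasure q).real (constantOn s b) = (if b then 1 - (q : ℝ) else q) ^ s.card := by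
  have h : (siteMeasure q).real {b} = if b then 1 - (q : ℝ) else q := by
    cases b <;> simp [siteMeasure]
  rw [← h, measureReal_def, measureReal_def, constantOn, stationaryMeasure,
    Measure.infinitePi_pi _ fun _ _ => measurableSet_singleton b, Finset.prod_const,
    ENNReal.toReal_pow]

/-- The empty sites of a configuration at distance at most `L` to the left of the origin, given by
their distance to the origin. -/
def emptySites (L : ℕ) (σ : Config) : Finset ℕ :=
  (Finset.Icc 1 L).filter fun d => σ (-(d : ℤ)) = false

theorem mem_emptySites {L d : ℕ} {σ : Config} :
    d ∈ emptySites L σ ↔ (1 ≤ d ∧ d ≤ L) ∧ σ (-(d : ℤ)) = false := by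
  simp [emptySites]

/-- The sites at distance at most `L` to the left of the origin. -/
def leftWindow (L : ℕ) : Finset ℤ :=
  (Finset.Icc 1 L).image fun d : ℕ => -(d : ℤ)

theorem mem_leftWindow {L : ℕ} {x : ℤ} : x ∈ leftWindow L ↔ ∃ d : ℕ, (1 ≤ d ∧ d ≤ L) ∧ -d = x := by
  simp [leftWindow]

theorem card_leftWindow (L : ℕ) : (leftWindow L).card = L := by
  rw [leftWindow, Finset.card_image_of_injective _ fun a b h => by simpa using h]
  simp

theorem emptySites_congr {L : ℕ} {σ τ : Config} (h : ∀ x ∈ leftWindow L, σ x = τ x) :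
    emptySites L σ = emptySites L τ := by
  ext d
  simp only [mem_emptySites]
  exact and_congr_right fun hd => by rw [h _ (mem_leftWindow.2 ⟨d, hd, rfl⟩)]

open Classical in
/-- The indicator of the event that the empty sites of the window of length `L` can be removed by
legal steps using at most `k` empty sites at a time. -/
noncomputable def emptiableIndicator (k L : ℕ) (σ : Config) : ℝ :=
  if Emptiable k (emptySites L σ) then 1 else 0

theorem emptiableIndicator_congr {k L : ℕ} {σ τ : Config} (h : ∀ x ∈ leftWindow L, σ x = τ x) :
    emptiableIndicator k L σ = emptiableIndicator k L τ := by
  rw [emptiableIndicator, emptiableIndicator, emptySites_congr h]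

theorem isLocal_emptiableIndicator (k L : ℕ) : IsLocal (emptiableIndicator k L) :=
  ⟨leftWindow L, fun _ _ h => emptiableIndicator_congr fun x hx => h x (Finset.mem_coe.2 hx)⟩

theorem emptiableIndicator_nonneg (k L : ℕ) (σ : Config) : 0 ≤ emptiableIndicator k L σ := by
  unfold emptiableIndicator
  split_ifs <;> norm_num

theorem emptiableIndicator_le_one (k L : ℕ) (σ : Config) : emptiableIndicator k L σ ≤ 1 := by
  unfold emptiableIndicator
  split_ifs <;> norm_num

theorem pow_le_integral_emptiableIndicator (q : unitInterval) (k L : ℕ) :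
    (1 - (q : ℝ)) ^ L ≤ ∫ σ, emptiableIndicator k L σ ∂stationaryMeasure q := by
  have h := measureReal_constantOn q (leftWindow L) true
  rw [card_leftWindow, if_pos rfl] at h
  rw [← h, ← integral_indicator_one (measurableSet_constantOn _ _)]
  refine integral_mono_of_nonneg (Eventually.of_forall fun σ => ?_)
    ((isLocal_emptiableIndicator k L).integrable q) (Eventually.of_forall fun σ => ?_)
  · exact Set.indicator_nonneg (fun _ _ => zero_le_one) σ
  · refine Set.indicator_apply_le' (fun hσ => ?_) fun _ => emptiableIndicator_nonneg k L σ
    have : emptySites L σ = ∅ := by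
      refine Finset.eq_empty_of_forall_notMem fun d hd => ?_
      rw [mem_emptySites] at hd
      rw [mem_constantOn.1 hσ _ (mem_leftWindow.2 ⟨d, hd.1, rfl⟩)] at hd
      simp at hd
    simp [emptiableIndicator, this, emptiable_empty]

/-- If the site at distance `L ≥ 2 ^ k` is empty, the set is not emptiable, by
`Emptiable.lt_two_pow`. -/
theorem le_one_sub_integral_emptiableIndicator (q : unitInterval) {k L : ℕ} (hL : 2 ^ k ≤ L) :
    (q : ℝ) ≤ 1 - ∫ σ, emptiableIndicator k L σ ∂stationaryMeasure q := by
  have hi := (isLocal_emptiableIndicator k L).integrable q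
  have h := measureReal_constantOn q {-(L : ℤ)} false
  rw [Finset.card_singleton, pow_one, if_neg (by simp)] at h
  have h1 : (1 : ℝ) = ∫ _, (1 : ℝ) ∂stationaryMeasure q := by simp
  conv_lhs => rw [← h, ← integral_indicator_one (measurableSet_constantOn _ _)]
  rw [h1, ← integral_sub (integrable_const 1) hi]
  refine integral_mono_of_nonneg (Eventually.of_forall fun σ => ?_)
    ((integrable_const 1).sub hi) (Eventually.of_forall fun σ => ?_)
  · exact Set.indicator_nonneg (fun _ _ => zero_le_one) σ
  · refine Set.indicator_apply_le' (fun hσ => ?_) fun _ =>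
      sub_nonneg.2 (emptiableIndicator_le_one k L σ)
    have hmem : L ∈ emptySites L σ := mem_emptySites.2
      ⟨⟨Nat.one_le_two_pow.trans hL, le_rfl⟩, mem_constantOn.1 hσ _ (Finset.mem_singleton_self _)⟩
    have : ¬ Emptiable k (emptySites L σ) := fun h => absurd (h.lt_two_pow hmem) (by omega)
    simp [emptiableIndicator, this]

theorem variance_emptiableIndicator (q : unitInterval) (k L : ℕ) :
    variance (emptiableIndicator k L) (stationaryMeasure q)
      = (∫ σ, emptiableIndicator k L σ ∂stationaryMeasure q) *
        (1 - ∫ σ, emptiableIndicator k L σ ∂stationaryMeasure q) := by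
  have hf := isLocal_emptiableIndicator k L
  have hsq : emptiableIndicator k L ^ 2 = emptiableIndicator k L := by
    ext σ
    by_cases h : Emptiable k (emptySites L σ) <;> simp [emptiableIndicator, h]
  rw [variance_eq_sub, hsq]
  · ring
  · exact MemLp.of_bound hf.measurable.aestronglyMeasurable 1 (Eventually.of_forall fun σ => by
      rw [Real.norm_of_nonneg (emptiableIndicator_nonneg k L σ)]
      exact emptiableIndicator_le_one k L σ)

/-! ### The bottleneck event and the Dirichlet form -/

/-- The event that the sites of some hierarchical set with `k` elements are all empty. -/
def hierarchicalEvent (k : ℕ) : Set Config :=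
  ⋃ S ∈ (hierarchical 0 k).filter (·.card = k), constantOn (S.image fun d : ℕ => -(d : ℤ)) false

theorem measurableSet_hierarchicalEvent (k : ℕ) : MeasurableSet (hierarchicalEvent k) :=
  Finset.measurableSet_biUnion _ fun _ _ => measurableSet_constantOn _ _

theorem measureReal_hierarchicalEvent_le (q : unitInterval) (k : ℕ) :
    (stationaryMeasure q).real (hierarchicalEvent k)
      ≤ k.factorial * 2 ^ k.choose 2 * (q : ℝ) ^ k := by
  have hq : 0 ≤ (q : ℝ) ^ k := pow_nonneg q.2.1 k
  have hcard : (((hierarchical 0 k).filter (·.card = k)).card : ℝ)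
      ≤ k.factorial * 2 ^ k.choose 2 := by
    have h := (Finset.card_filter_le (hierarchical 0 k) (·.card = k)).trans
      (card_hierarchical_le 0 k)
    rw [zero_mul, zero_add] at h
    exact_mod_cast h
  refine (measureReal_biUnion_finset_le _ _).trans ?_
  refine le_trans (le_of_eq ?_) (mul_le_mul_of_nonneg_right hcard hq)
  rw [← nsmul_eq_mul]
  refine Finset.sum_eq_card_nsmul fun S hS => ?_
  rw [measureReal_constantOn, Finset.card_image_of_injective _ fun a b h => by simpa using h,
    (Finset.mem_filter.1 hS).2, if_neg (by simp)]

/-- A legal flip changes the indicator only next to a hierarchical set of maximal size. -/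
theorem mem_hierarchicalEvent_of_ne {k L : ℕ} {x : ℤ} {σ : Config} (hx : σ (x + 1) = false)
    (hne : emptiableIndicator k L (Function.update σ x true)
      ≠ emptiableIndicator k L (Function.update σ x false)) : σ ∈ hierarchicalEvent k := by
  obtain ⟨d, hd, rfl⟩ : ∃ d : ℕ, (1 ≤ d ∧ d ≤ L) ∧ -d = x := by
    rw [← mem_leftWindow]
    by_contra hcon
    refine hne (emptiableIndicator_congr fun y hy => ?_)
    have hyx : y ≠ x := by
      rintro rfl
      exact hcon hy
    simp [hyx]
  set E₁ := emptySites L (Function.update σ (-d) true) with hE₁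
  set E₀ := emptySites L (Function.update σ (-d) false) with hE₀
  have hmem : ∀ b e, e ≠ d → (e ∈ emptySites L (Function.update σ (-d) b) ↔
      (1 ≤ e ∧ e ≤ L) ∧ σ (-e) = false) := fun b e he => by
    rw [mem_emptySites, Function.update_of_ne (by simpa using he)]
  have hE₁' : ∀ e ∈ E₁, (1 ≤ e ∧ e ≤ L) ∧ σ (-e) = false := fun e he => by
    refine (hmem true e ?_).1 he
    rintro rfl
    simp [hE₁, mem_emptySites] at he
  have hsub : E₁ ⊆ E₀ := fun e he => by
    by_cases hed : e = d
    · subst hed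
      simp [hE₁, mem_emptySites] at he
    · exact (hmem false e hed).2 (hE₁' e he)
  have hins : E₀ ⊆ insert d E₁ := fun e he => by
    by_cases hed : e = d
    · simp [hed]
    · exact Finset.mem_insert_of_mem ((hmem true e hed).2 ((hmem false e hed).1 he))
  have hstep : LegalStep E₁ E₀ := by
    refine ⟨d - 1, ?_, fun e he => ?_⟩
    · refine or_iff_not_imp_left.2 fun h0 => ?_
      have : (1 ≤ d - 1 ∧ d - 1 ≤ L) ∧ σ (-(d - 1 : ℕ)) = false := by
        refine ⟨by omega, ?_⟩
        rw [← hx]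
        congr 1
        omega
      exact ⟨(hmem _ _ (by omega)).2 this, (hmem _ _ (by omega)).2 this⟩
    · rw [hE₁, hE₀, hmem _ _ (by omega), hmem _ _ (by omega)]
  have hnot : ¬ (Emptiable k E₁ ↔ Emptiable k E₀) := fun h => hne (by
    unfold emptiableIndicator
    classical exact if_congr h rfl rfl)
  -- From `E₁` one can step to the larger `E₀`, so only `E₁` can be the emptiable one. With fewer
  -- than `k` points in `E₁`, stepping back would empty `E₀` as well.
  have h10 : Emptiable k E₀ → Emptiable k E₁ := fun h =>
    h.of_legalStep hstep ((Finset.card_le_card hsub).trans h.card_le)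
  have h1 : Emptiable k E₁ := by tauto
  have h0 : ¬ Emptiable k E₀ := by tauto
  have hcard : E₁.card = k := by
    refine le_antisymm h1.card_le ?_
    by_contra! hlt
    exact h0 (h1.of_legalStep hstep.symm
      ((Finset.card_le_card hins).trans ((Finset.card_insert_le _ _).trans hlt)))
  have hh := h1.mem_hierarchical
  rw [hcard, Nat.sub_self] at hh
  refine Set.mem_biUnion (Finset.mem_coe.2 (Finset.mem_filter.2 ⟨hh, hcard⟩)) ?_
  rw [mem_constantOn]
  intro y hy
  obtain ⟨e, he, rfl⟩ := Finset.mem_image.1 hy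
  exact (hE₁' e he).2

theorem dirichletForm_emptiableIndicator_le (q : unitInterval) (k L : ℕ) :
    dirichletForm q (emptiableIndicator k L)
      ≤ L * ((q : ℝ) * (1 - q) * (k.factorial * 2 ^ k.choose 2 * (q : ℝ) ^ k)) := by
  have hqq : 0 ≤ (q : ℝ) * (1 - q) := mul_nonneg q.2.1 (sub_nonneg.2 q.2.2)
  have hsum : dirichletForm q (emptiableIndicator k L) = ∑ x ∈ leftWindow L,
      ∫ σ, constraint x σ * siteVariance q x (emptiableIndicator k L) σ ∂stationaryMeasure q := by
    refine tsum_eq_sum fun x hx => integral_eq_zero_of_ae (Eventually.of_forall fun σ => ?_)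
    have : emptiableIndicator k L (Function.update σ x true)
        = emptiableIndicator k L (Function.update σ x false) :=
      emptiableIndicator_congr fun y hy => by
        have hyx : y ≠ x := by
          rintro rfl
          exact hx hy
        simp [hyx]
    simp [siteVariance_eq_sq, this]
  rw [hsum]
  refine (Finset.sum_le_card_nsmul _ _ _ fun x _ => ?_).trans_eq
    (by rw [card_leftWindow, nsmul_eq_mul])
  refine le_trans ?_ (mul_le_mul_of_nonneg_left (measureReal_hierarchicalEvent_le q k) hqq)
  rw [mul_comm, ← smul_eq_mul, ← integral_indicator_const _ (measurableSet_hierarchicalEvent k)]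
  refine integral_mono_of_nonneg (Eventually.of_forall fun σ =>
      mul_nonneg (constraint_nonneg x σ) (variance_nonneg _ _))
    ((integrable_const _).indicator (measurableSet_hierarchicalEvent k))
    (Eventually.of_forall fun σ => ?_)
  -- The single-site variance of a `[0, 1]`-valued function is at most `q * (1 - q)`; off the event
  -- the flip is blocked or changes nothing.
  refine Set.le_indicator_apply (fun _ => ?_) fun hσ => le_of_eq ?_
  · beta_reduce
    rw [siteVariance_eq_sq]
    have h1 := emptiableIndicator_nonneg k L (Function.update σ x true)
    have h2 := emptiableIndicator_nonneg k L (Function.update σ x false)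
    have h3 := emptiableIndicator_le_one k L (Function.update σ x true)
    have h4 := emptiableIndicator_le_one k L (Function.update σ x false)
    have hc : constraint x σ ≤ 1 := by
      unfold constraint
      split_ifs <;> norm_num
    have hsq : (emptiableIndicator k L (Function.update σ x true)
        - emptiableIndicator k L (Function.update σ x false)) ^ 2 ≤ 1 := by
      rw [sq_le_one_iff_abs_le_one, abs_le]
      constructor <;> linarith
    calc _ ≤ 1 * ((q : ℝ) * (1 - q) * 1) := by gcongr
      _ = _ := by ring
  · by_cases hx : σ (x + 1) = false
    · have : emptiableIndicator k L (Function.update σ x true)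
          = emptiableIndicator k L (Function.update σ x false) := by
        by_contra hne
        exact hσ (mem_hierarchicalEvent_of_ne hx hne)
      simp [siteVariance_eq_sq, this]
    · simp [constraint, hx]

theorem spectralGap_mul_le (hq₀ : 0 < q) (hq₁ : q < 1) (k : ℕ) :
    spectralGap q * (1 - (q : ℝ)) ^ (2 ^ k - 1)
      ≤ 2 ^ k * (k.factorial * 2 ^ k.choose 2 * (q : ℝ) ^ k) := by
  have hq0 : (0 : ℝ) < q := hq₀
  have hq1 : (0 : ℝ) < 1 - q := sub_pos.2 hq₁
  have hp := pow_le_integral_emptiableIndicator q k (2 ^ k)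
  have hr := le_one_sub_integral_emptiableIndicator q (le_refl (2 ^ k))
  have hv := variance_emptiableIndicator q k (2 ^ k)
  have hD := dirichletForm_emptiableIndicator_le q k (2 ^ k)
  have hvar : (1 - (q : ℝ)) ^ 2 ^ k * q
      ≤ variance (emptiableIndicator k (2 ^ k)) (stationaryMeasure q) := by
    rw [hv]
    exact mul_le_mul hp hr hq0.le ((pow_pos hq1 _).le.trans hp)
  have hpos : 0 < (1 - (q : ℝ)) ^ 2 ^ k * q := by positivity
  have hgap := spectralGap_le_div (isLocal_emptiableIndicator k (2 ^ k)) (hpos.trans_le hvar).ne'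
  have h := hgap.trans (div_le_div₀ (by positivity) hD hpos hvar)
  rw [le_div_iff₀ hpos] at h
  -- One factor `1 - q` cancels against the single-site variance, which keeps the bound uniform as
  -- `q` approaches `1`.
  have hsplit : (1 - (q : ℝ)) ^ 2 ^ k = (1 - (q : ℝ)) ^ (2 ^ k - 1) * (1 - q) := by
    rw [← pow_succ, Nat.sub_add_cancel Nat.one_le_two_pow]
  rw [hsplit] at h
  push_cast at h
  refine le_of_mul_le_mul_right ?_ (mul_pos hq0 hq1)
  linarith

end Measure

/-! ### Choice of `k` and asymptotics -/

/-- `k! * 2 ^ k ≤ (2 * k) ^ k` and `2 * k ≤ c ^ k` for large `k`; `M` takes care of the finitely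
many others. -/
theorem exists_factorial_mul_two_pow_le {c : ℝ} (hc : 1 < c) :
    ∃ M : ℝ, 0 < M ∧ ∀ k : ℕ, (k.factorial : ℝ) * 2 ^ k ≤ M * c ^ (k * k) := by
  have hlim := (tendsto_pow_const_div_const_pow_of_one_lt 1 hc).const_mul 2
  rw [mul_zero] at hlim
  obtain ⟨N, hN⟩ := eventually_atTop.1 (hlim.eventually_le_const one_pos)
  have hnn : ∀ k : ℕ, 0 ≤ (k.factorial : ℝ) * 2 ^ k := fun k => by positivity
  have hsum := Finset.sum_nonneg fun k (_ : k ∈ Finset.range N) => hnn k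
  refine ⟨1 + ∑ k ∈ Finset.range N, (k.factorial : ℝ) * 2 ^ k, by linarith, fun k => ?_⟩
  have h1 : 1 ≤ c ^ (k * k) := one_le_pow₀ hc.le
  rcases lt_or_ge k N with hk | hk
  · have h := Finset.single_le_sum (fun k _ => hnn k) (Finset.mem_range.2 hk)
    calc _ ≤ _ := h
      _ ≤ (1 + ∑ k ∈ Finset.range N, (k.factorial : ℝ) * 2 ^ k) * 1 := by linarith
      _ ≤ _ := mul_le_mul_of_nonneg_left h1 (by linarith)
  · have h2 : (k : ℝ) * 2 ≤ c ^ k := by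
      have h := hN k hk
      rw [pow_one, ← mul_div_assoc, div_le_one (by positivity)] at h
      linarith
    calc (k.factorial : ℝ) * 2 ^ k ≤ (k : ℝ) ^ k * 2 ^ k := by
          gcongr
          exact_mod_cast Nat.factorial_le_pow k
      _ = ((k : ℝ) * 2) ^ k := (mul_pow _ _ _).symm
      _ ≤ (c ^ k) ^ k := by gcongr
      _ = 1 * c ^ (k * k) := by rw [pow_mul, one_mul]
      _ ≤ _ := mul_le_mul_of_nonneg_right (by linarith) (by positivity)

/-- For `q ≤ 1 / 2` one has `log (1 - q) ≥ -2 * q`; for `q > 1 / 2` the hypothesis forces `k = 0`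
and the exponent vanishes. -/
theorem exp_neg_two_le_one_sub_pow {q : ℝ} (hq₀ : 0 < q) (hq₁ : q < 1) {k : ℕ}
    (hk : 2 ^ k * q ≤ 1) : Real.exp (-2) ≤ (1 - q) ^ (2 ^ k - 1) := by
  rcases le_or_gt q (1 / 2) with hq | hq
  · have h1 : (0 : ℝ) < 1 - q := by linarith
    have hlog : -(2 * q) ≤ Real.log (1 - q) := by
      refine le_trans ?_ (Real.one_sub_inv_le_log_of_pos h1)
      have : (1 - q)⁻¹ ≤ 1 + 2 * q := by
        rw [inv_le_iff_one_le_mul₀ h1]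
        nlinarith
      linarith
    rw [← Real.le_log_iff_exp_le (by positivity), Real.log_pow,
      Nat.cast_sub Nat.one_le_two_pow]
    push_cast
    have h2 : (0 : ℝ) ≤ 2 ^ k - 1 := sub_nonneg.2 (one_le_pow₀ (by norm_num))
    nlinarith
  · have : k = 0 := by
      by_contra hk0
      have : (2 : ℝ) ^ 1 ≤ 2 ^ k := pow_le_pow_right₀ (by norm_num) (by omega)
      nlinarith
    subst this
    simp

theorem exists_spectralGap_le {δ : ℝ} (hδ₀ : 0 < δ) :
    ∃ C : ℝ, 0 < C ∧ ∀ q : unitInterval, 0 < q → q < 1 →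
      spectralGap q ≤ C * (q : ℝ) ^ (Real.logb 2 (1 / (q : ℝ)) * (1 - δ) / 2) := by
  obtain ⟨M, hM, hMk⟩ := exists_factorial_mul_two_pow_le
    (Real.one_lt_rpow one_lt_two (half_pos hδ₀))
  refine ⟨Real.exp 2 * (2 * M), by positivity, fun q hq₀ hq₁ => ?_⟩
  have hq0 : (0 : ℝ) < q := hq₀
  have hq1 : (q : ℝ) < 1 := hq₁
  set n := Real.logb 2 (1 / (q : ℝ)) with hn
  have hqn : (q : ℝ) = 2 ^ (-n) := by
    rw [Real.rpow_neg two_pos.le, hn, Real.rpow_logb two_pos (by norm_num) (by positivity)]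
    simp
  have hn0 : 0 ≤ n := Real.logb_nonneg one_lt_two ((one_le_div hq0).2 hq1.le)
  set k := ⌊n⌋₊
  have hkn : (k : ℝ) ≤ n := Nat.floor_le hn0
  have hnk : n < k + 1 := Nat.lt_floor_add_one n
  have hk : (2 : ℝ) ^ k * q ≤ 1 := by
    rw [hqn, ← Real.rpow_natCast, ← Real.rpow_add two_pos]
    exact Real.rpow_le_one_of_one_le_of_nonpos one_le_two (by linarith)
  have hgap : spectralGap q
      ≤ Real.exp 2 * (2 ^ k * (k.factorial * 2 ^ k.choose 2 * (q : ℝ) ^ k)) := by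
    have hexp := exp_neg_two_le_one_sub_pow hq0 hq1 hk
    have h := spectralGap_mul_le hq₀ hq₁ k
    have hpos := (Real.exp_pos (-2)).trans_le hexp
    rw [← le_div_iff₀ hpos] at h
    refine h.trans ?_
    rw [div_le_iff₀ hpos]
    have he : 1 ≤ Real.exp 2 * (1 - (q : ℝ)) ^ (2 ^ k - 1) := by
      calc (1 : ℝ) = Real.exp 2 * Real.exp (-2) := by rw [← Real.exp_add]; simp
        _ ≤ _ := by gcongr
    have hX : 0 ≤ (2 : ℝ) ^ k * (k.factorial * 2 ^ k.choose 2 * (q : ℝ) ^ k) := by positivity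
    nlinarith
  refine hgap.trans ?_
  rw [mul_assoc (Real.exp 2) (2 * M)]
  refine mul_le_mul_of_nonneg_left ?_ (Real.exp_pos 2).le
  have hpow : (2 : ℝ) ^ k.choose 2 * (q : ℝ) ^ k
      ≤ 2 * 2 ^ (-(n * n * (1 - δ) / 2)) * (2 ^ (-(δ / 2) * (k * k))) := by
    have hrhs : ∀ u v : ℝ, 2 * (2 : ℝ) ^ u * 2 ^ v = 2 ^ (1 + u + v) := fun u v => by
      rw [Real.rpow_add two_pos, Real.rpow_add two_pos, Real.rpow_one]
    rw [hrhs, hqn, ← Real.rpow_natCast, ← Real.rpow_natCast, ← Real.rpow_mul two_pos.le,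
      ← Real.rpow_add two_pos, Nat.cast_choose_two]
    refine Real.rpow_le_rpow_of_exponent_le one_le_two ?_
    -- Completing the square, `k ^ 2 / 2 - n * k = (n - k) ^ 2 / 2 - n ^ 2 / 2`, and rounding costs
    -- at most `1 / 2`.
    have h1 : (n - k) * (n - k) ≤ 1 * 1 :=
      mul_self_le_mul_self (by linarith) (by linarith)
    have h2 : δ * ((k : ℝ) * k) ≤ δ * (n * n) :=
      mul_le_mul_of_nonneg_left (mul_self_le_mul_self k.cast_nonneg hkn) hδ₀.le
    have h3 : (0 : ℝ) ≤ k := k.cast_nonneg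
    linarith
  have hc : ((2 : ℝ) ^ (δ / 2)) ^ (k * k) = 2 ^ (δ / 2 * (k * k)) := by
    rw [← Real.rpow_natCast, ← Real.rpow_mul two_pos.le]
    push_cast
    rfl
  have hqpow : (q : ℝ) ^ (n * (1 - δ) / 2) = 2 ^ (-(n * n * (1 - δ) / 2)) := by
    conv_lhs => rw [hqn]
    rw [← Real.rpow_mul two_pos.le]
    congr 1
    ring
  have hMk' := hMk k
  rw [hc] at hMk'
  calc (2 : ℝ) ^ k * (k.factorial * 2 ^ k.choose 2 * (q : ℝ) ^ k)
      = (k.factorial * 2 ^ k) * (2 ^ k.choose 2 * (q : ℝ) ^ k) := by ring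
    _ ≤ (M * 2 ^ (δ / 2 * (k * k)))
        * (2 * 2 ^ (-(n * n * (1 - δ) / 2)) * (2 ^ (-(δ / 2) * (k * k)))) := by gcongr
    _ = 2 * M * 2 ^ (-(n * n * (1 - δ) / 2))
        * ((2 : ℝ) ^ (δ / 2 * (k * k)) * (2 ^ (-(δ / 2) * (k * k)))) := by ring
    _ = _ := by
      rw [← Real.rpow_add two_pos, hqpow]
      simp

/-! ### The lower limit -/

theorem tendsto_log_one_div_unitInterval :
    Tendsto (fun q : unitInterval => Real.log (1 / (q : ℝ))) (𝓝[>] 0) atTop := by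
  have h : Tendsto (fun q : unitInterval => (q : ℝ)) (𝓝[>] 0) (𝓝[>] 0) := by
    refine tendsto_nhdsWithin_iff.2 ⟨?_, eventually_nhdsWithin_of_forall fun q hq => ?_⟩
    · exact (continuous_subtype_val.tendsto (0 : unitInterval)).mono_left nhdsWithin_le_nhds
    · exact hq
  simp only [one_div]
  exact Real.tendsto_log_atTop.comp (tendsto_inv_nhdsGT_zero.comp h)

theorem le_log_inv_spectralGap_div {C δ r : ℝ} (hC : 0 < C) {q : unitInterval} (hq₀ : 0 < q)
    (hgap : spectralGap q ≤ C * (q : ℝ) ^ (Real.logb 2 (1 / (q : ℝ)) * (1 - δ) / 2))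
    (hX : 0 < Real.log (1 / (q : ℝ)))
    (hr : r * Real.log (1 / (q : ℝ)) ^ 2
      ≤ (1 - δ) * (2 * Real.log 2)⁻¹ * Real.log (1 / (q : ℝ)) ^ 2 - Real.log C) :
    (r : EReal) ≤ ENNReal.log (ENNReal.ofReal (spectralGap q))⁻¹ /
      ((Real.log (1 / (q : ℝ)) ^ 2 : ℝ) : EReal) := by
  have hq0 : (0 : ℝ) < q := hq₀
  have hl2 := Real.log_pos one_lt_two
  set B := C * (q : ℝ) ^ (Real.logb 2 (1 / (q : ℝ)) * (1 - δ) / 2) with hB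
  have hB0 : 0 < B := by positivity
  have hlogB : Real.log B⁻¹
      = (1 - δ) * (2 * Real.log 2)⁻¹ * Real.log (1 / (q : ℝ)) ^ 2 - Real.log C := by
    rw [Real.log_inv, hB, Real.log_mul hC.ne' (by positivity), Real.log_rpow hq0, Real.logb,
      one_div, Real.log_inv]
    field_simp
    ring
  have h1 : ((Real.log B⁻¹ : ℝ) : EReal) ≤ ENNReal.log (ENNReal.ofReal (spectralGap q))⁻¹ := by
    rw [← ENNReal.log_ofReal_of_pos (inv_pos.2 hB0), ENNReal.ofReal_inv_of_pos hB0]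
    exact ENNReal.log_le_log (ENNReal.inv_le_inv.2 (ENNReal.ofReal_le_ofReal hgap))
  have hX2 : 0 < Real.log (1 / (q : ℝ)) ^ 2 := by positivity
  refine le_trans ?_ (EReal.div_le_div_right_of_nonneg (EReal.coe_nonneg.2 hX2.le) h1)
  rw [← EReal.coe_div, EReal.coe_le_coe_iff, le_div_iff₀ hX2, hlogB]
  exact hr

end EastModel

theorem mainTheorem6 :
    (∀ δ : ℝ, 0 < δ → δ < 1 → ∃ C : ℝ, 0 < C ∧ ∀ q : unitInterval, 0 < q → q < 1 →
      EastModel.spectralGap q ≤ C * (q : ℝ) ^ (Real.logb 2 (1 / (q : ℝ)) * (1 - δ) / 2)) ∧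
    (((2 * Real.log 2)⁻¹ : ℝ) : EReal) ≤
      liminf (fun q : unitInterval =>
        ENNReal.log (ENNReal.ofReal (EastModel.spectralGap q))⁻¹ /
          ((Real.log (1 / (q : ℝ)) ^ 2 : ℝ) : EReal)) (𝓝[>] (0 : unitInterval)) := by
  refine ⟨fun δ hδ₀ _ => EastModel.exists_spectralGap_le hδ₀, ?_⟩
  set a : ℝ := (2 * Real.log 2)⁻¹ with ha
  have ha0 : 0 < a := inv_pos.2 (mul_pos two_pos (Real.log_pos one_lt_two))
  refine le_of_forall_lt fun c hc => ?_
  obtain ⟨r, hcr, hra⟩ := EReal.lt_iff_exists_real_btwn.1 hc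
  rw [EReal.coe_lt_coe_iff] at hra
  refine hcr.trans_le ?_
  -- With this `δ` half of the slack `a - r` remains, and times `log (1 / q) ^ 2` it eventually
  -- exceeds `log C`.
  have hδ₀ : 0 < (a - r) / (2 * a) := div_pos (by linarith) (by positivity)
  set δ := (a - r) / (2 * a) with hδ
  have hgain : (1 - δ) * a - r = (a - r) / 2 := by
    rw [hδ]
    field_simp
    ring
  obtain ⟨C, hC, hCq⟩ := EastModel.exists_spectralGap_le hδ₀
  refine le_liminf_of_le (by isBoundedDefault) ?_
  have hX := EastModel.tendsto_log_one_div_unitInterval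
  have hX2 := (tendsto_pow_atTop two_ne_zero).comp hX
  filter_upwards [self_mem_nhdsWithin, hX.eventually_gt_atTop 0,
    hX2.eventually_ge_atTop (Real.log C / ((a - r) / 2))] with q hq hpos hlarge
  have hq0 : (0 : unitInterval) < q := hq
  have hq1 : q < 1 := by
    refine lt_of_le_of_ne q.2.2 ?_
    rintro rfl
    simp at hpos
  refine EastModel.le_log_inv_spectralGap_div hC hq0 (hCq q hq0 hq1) hpos ?_
  rw [Function.comp_apply, div_le_iff₀ (by linarith), ← hgain] at hlarge
  rw [← ha]
  linarith
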